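/- A signed graph $(G,\sigma)$ is a graph $G$ (loops and parallel edges allowed) with a sign $\sigma(e)\in\{+1,-1\}$ on every edge $e$. Switching a vertex $v$ changes the signs of all non-loop edges at $v$. The signed graph is balanced if some sequence of vertex switchings makes all its edges positive, and a set $X$ of vertices is balanced if the signed subgraph induced by $X$ is balanced. A balanced $p$-colouring is a map from the vertex set to a set of $p$ colours all of whose colour classes are balanced (for $p=0$ it exists exactly when there are no vertices), and the balanced chromatic number $\chi_b(G,\sigma)$ is the least $p$ for which a balanced $p$-colouring exists. For integers $n\ge k\ge 1$, a signed $k$-subset of $[n]$ is a $k$-element set $A\subseteq\{\pm1,\dots,\pm n\}$ with $A\cap(-A)=\emptyset$. It is alternating if it is of the form $\{a_1,-a_2,\dots,(-1)^{k-1}a_k\}$ or $\{-a_1,a_2,\dots,(-1)^{k}a_k\}$ with $1\le a_1<a_2<\dots<a_k\le n$. Let $\widehat S(n,k)$ be the signed graph whose vertices are the alternating signed $k$-subsets of $[n]$ whose element of least absolute value is positive, where $A,B$ (possibly equal) are joined by a positive edge if $A\cap(-B)=\emptyset$ and by a negative edge if $A\cap B=\emptyset$ (by both, if both hold). Theorem.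 For all integers $n\ge k\ge 1$, $$\chi_b(\widehat S(n,k))=n-k+1 .$$ Moreover, for every vertex $A$ of $\widehat S(n,k)$, the signed graph $\widehat S(n,k)-A$ admits a balanced $(n-k)$-colouring. In particular $\widehat S(n,k)$ is vertex-critical: deleting any vertex decreases its balanced chromatic number. -/

import Mathlib

/-- A signed graph `(G, σ)`: a multigraph (loops and parallel edges allowed) together with a
signature. Only the values of `sign` on the edge set of `graph` matter. -/
structure SignedGraph (α β : Type*) where
  graph : Graph α β
  sign : β → ℤˣ

namespace SignedGraph

variable {α β : Type*}

open Classical in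
/-- The signature obtained from `σ` by switching the vertex `v`: the signs of all non-loop edges
incident with `v` are changed. -/
noncomputable def switchVertex (G : Graph α β) (σ : β → ℤˣ) (v : α) : β → ℤˣ :=
  fun e => if ∃ w, w ≠ v ∧ G.IsLink e v w then -σ e else σ e

/-- Two signatures on `G` are switching equivalent if a sequence of switchings of vertices of `G`
turns the first one into the second one (on the edges of `G`). -/
def SwitchingEquivalent (G : Graph α β) (σ₁ σ₂ : β → ℤˣ) : Prop :=
  ∃ l : List α, (∀ v ∈ l, v ∈ G.vertexSet) ∧
    ∀ e ∈ G.edgeSet, l.foldl (switchVertex G) σ₁ e = σ₂ e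

/-- `(G, σ)` is balanced if it is switching equivalent to `(G, +)`. -/
def Balanced (S : SignedGraph α β) : Prop :=
  SwitchingEquivalent S.graph S.sign (fun _ => 1)

/-- The subgraph induced by the vertices in `X`, with the inherited signature. -/
def induce (S : SignedGraph α β) (X : Set α) : SignedGraph α β :=
  ⟨S.graph.induce X, S.sign⟩

/-- The signed graph with the vertex `v` deleted. -/
def deleteVertex (S : SignedGraph α β) (v : α) : SignedGraph α β :=
  ⟨S.graph.deleteVerts {v}, S.sign⟩

/-- A set of vertices is balanced if it induces a balanced signed graph. -/
def BalancedSet (S : SignedGraph α β) (X : Set α) : Prop :=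
  (S.induce X).Balanced

/-- There is a balanced `p`-colouring: a map from the vertex set to `p` colours all of whose colour
classes are balanced. For `p = 0` this says that there is no vertex. -/
def BalancedColorable (S : SignedGraph α β) (p : ℕ) : Prop :=
  ∃ f : S.graph.vertexSet → Fin p, ∀ i : Fin p, S.BalancedSet (Subtype.val '' (f ⁻¹' {i}))

/-- The balanced chromatic number: the least `p` for which there is a balanced `p`-colouring
(`⊤` if there is none). -/
noncomputable def balancedChromaticNumber (S : SignedGraph α β) : ℕ∞ :=
  ⨅ p ∈ {p : ℕ | S.BalancedColorable p}, (p : ℕ∞)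

/-- Vertex-critical with respect to balanced colouring: deleting any vertex decreases the balanced
chromatic number. -/
def VertexCritical (S : SignedGraph α β) : Prop :=
  ∀ v ∈ S.graph.vertexSet,
    (S.deleteVertex v).balancedChromaticNumber < S.balancedChromaticNumber

end SignedGraph

/-- `-A = {-a : a ∈ A}`. -/
def negSet (A : Finset ℤ) : Finset ℤ := A.image (fun a => -a)

/-- `A` is a signed `k`-subset of `[n]`: a `k`-subset of `{±1, …, ±n}` with `A ∩ (-A) = ∅`. -/
def IsSignedSubset (n k : ℕ) (A : Finset ℤ) : Prop :=
  (∀ a ∈ A, 1 ≤ |a| ∧ |a| ≤ (n : ℤ)) ∧ A.card = k ∧ Disjoint A (negSet A)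

/-- `A` is `{a₁, -a₂, …, (-1)^(k-1) a_k}` or `{-a₁, a₂, …, (-1)^k a_k}` for some
`1 ≤ a₁ < ⋯ < a_k ≤ n`. -/
def IsAlternating (n k : ℕ) (A : Finset ℤ) : Prop :=
  ∃ a : Fin k → ℤ, StrictMono a ∧ (∀ i, 1 ≤ a i ∧ a i ≤ (n : ℤ)) ∧
    (A = Finset.univ.image (fun i : Fin k => (-1) ^ (i : ℕ) * a i) ∨
     A = Finset.univ.image (fun i : Fin k => (-1) ^ ((i : ℕ) + 1) * a i))

/-- The first nonzero coordinate of the vector representing `A` is positive, i.e. the element of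
`A` of least absolute value is positive. -/
def FirstPositive (A : Finset ℤ) : Prop :=
  ∃ a ∈ A, 0 < a ∧ ∀ b ∈ A, a ≤ |b|

/-- The Kneser signed graph. The edge `(s(A, B), ε)` is the edge of sign `ε` joining `A` and `B`;
a positive one is present iff `A ∩ (-B) = ∅`, a negative one iff `A ∩ B = ∅`. -/
def kneserSignedGraph (n k : ℕ) : SignedGraph (Finset ℤ) (Sym2 (Finset ℤ) × ℤˣ) where
  graph :=
    { vertexSet := {A | IsSignedSubset n k A}
      IsLink := fun e A B => e.1 = s(A, B) ∧ IsSignedSubset n k A ∧ IsSignedSubset n k B ∧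
        ((e.2 = 1 ∧ Disjoint A (negSet B)) ∨ (e.2 = -1 ∧ Disjoint A B))
      isLink_symm := by
        intro e _
        refine ⟨fun A B h => ?_⟩
        obtain ⟨h1, hA, hB, h⟩ := h
        refine ⟨h1.trans Sym2.eq_swap, hB, hA, ?_⟩
        rcases h with ⟨h2, h⟩ | ⟨h2, h⟩
        · refine Or.inl ⟨h2, Finset.disjoint_left.2 fun x hx hx' => ?_⟩
          obtain ⟨y, hy, rfl⟩ := Finset.mem_image.1 hx'
          exact Finset.disjoint_left.1 h hy (Finset.mem_image.2 ⟨-y, hx, neg_neg y⟩)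
        · exact Or.inr ⟨h2, h.symm⟩
      eq_or_eq_of_isLink_of_isLink := by
        intro e x y v w h h'
        have h2 := h.1.symm.trans h'.1
        rcases Sym2.eq_iff.1 h2 with h3 | h3
        · exact Or.inl h3.1
        · exact Or.inr h3.1
      left_mem_of_isLink := fun _ _ _ h => h.2.1 }
  sign := fun e => e.2

/-- The Schrijver signed graph: the subgraph of the Kneser signed graph induced by the alternating
signed `k`-subsets. -/
def schrijverSignedGraph (n k : ℕ) : SignedGraph (Finset ℤ) (Sym2 (Finset ℤ) × ℤˣ) :=
  (kneserSignedGraph n k).induce {A | IsSignedSubset n k A ∧ IsAlternating n k A}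

/-- The subgraph of the Schrijver signed graph induced by the vertices whose first nonzero
coordinate is positive. -/
def schrijverSignedGraphHat (n k : ℕ) : SignedGraph (Finset ℤ) (Sym2 (Finset ℤ) × ℤˣ) :=
  (schrijverSignedGraph n k).induce
    {A | A ∈ (schrijverSignedGraph n k).graph.vertexSet ∧ FirstPositive A}

/-! Upper bound: vertices containing `x` or `-x` form a balanced class, with potential recording
which of the two occurs. Any `n-k+1` coordinates meet every alternating `k`-set. After deleting `A`,
the `n-k` coordinates outside `|A|` suffice, because a vertex is determined by its absolute values.

Lower bound: a potential on each class of a balanced `p`-colouring selects one of `B`, `-B` for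
every vertex `B`. No sign vector can contain both a selected set and the negative of a selected set
of the same colour, since this would give an edge of the wrong sign. If `p ≤ n-k`, label a sign
vector `X` by `±(k+c)`, where `c` is the least colour with a selected set in `X` or `-X`, the sign
telling which. If there is no such colour, use the signed length of a longest alternating subset,
which is below `k` in absolute value. The labelling is antipodal, has no complementary comparable
pair and stays below `n` in absolute value, contradicting Tucker's lemma (`exists_le_abs_label`).

Tucker's lemma is proved by parity: in each dimension `d ≤ n` the number of maximal chains with
positive alternating labels is odd (`alternatingChains_eq_one`), by counting facets over a
hemisphere. -/

/-! ### Alternating labels on a simplex and its facets -/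

/-- `S` is an alternating signed `m`-set whose element of least absolute value is positive. -/
def AlternatingPos (m : ℕ) (S : Finset ℤ) : Prop :=
  ∃ b : Fin m → ℤ, StrictMono (fun i => |b i|) ∧ (∀ i : Fin m, 0 < (-1) ^ (i : ℕ) * b i) ∧
    Finset.univ.image b = S

open Classical in
/-- The indicator of `AlternatingPos`, modulo two. -/
noncomputable def altIndicator (m : ℕ) (S : Finset ℤ) : ZMod 2 :=
  if AlternatingPos m S then 1 else 0

theorem AlternatingPos.card_image_abs {m : ℕ} {S : Finset ℤ} (h : AlternatingPos m S) :
    (S.image (fun x => |x|)).card = m := by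
  obtain ⟨b, hb, -, rfl⟩ := h
  rw [Finset.image_image]
  exact (Finset.card_image_of_injective _ hb.injective).trans (Finset.card_fin m)

theorem AlternatingPos.card {m : ℕ} {S : Finset ℤ} (h : AlternatingPos m S) : S.card = m := by
  obtain ⟨b, hb, -, rfl⟩ := h
  rw [Finset.card_image_of_injective, Finset.card_fin]
  exact fun i j hij => hb.injective (congrArg (fun x => |x|) hij)

theorem eq_of_image_eq_of_strictMono_abs {m : ℕ} {b l : Fin m → ℤ}
    (hb : StrictMono fun i => |b i|) (hl : StrictMono fun i => |l i|)
    (h : Finset.univ.image b = Finset.univ.image l) : b = l := by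
  have habs : (fun i => |b i|) = fun i => |l i| := by
    rw [← hb.range_inj hl]
    have h2 := congrArg (fun S : Finset ℤ => (fun x => |x|) '' (S : Set ℤ)) h
    simpa [← Set.range_comp, Function.comp_def] using h2
  funext i
  have hi : b i ∈ Finset.univ.image l := h ▸ Finset.mem_image_of_mem b (Finset.mem_univ i)
  obtain ⟨j, -, hj⟩ := Finset.mem_image.1 hi
  have h1 : |l j| = |l i| := by rw [hj]; exact congrFun habs i
  rw [← hj, hl.injective h1]

theorem alternatingPos_image_iff {m : ℕ} {l : Fin m → ℤ} (hl : StrictMono fun i => |l i|) :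
    AlternatingPos m (Finset.univ.image l) ↔ ∀ i : Fin m, 0 < (-1) ^ (i : ℕ) * l i := by
  constructor
  · rintro ⟨b, hb, hs, h⟩
    rwa [← eq_of_image_eq_of_strictMono_abs hb hl h]
  · exact fun h => ⟨l, hl, h, rfl⟩

/-- Put `P i = ∏_{j<i} a j * ∏_{j≥i} b j`. Inserting `1 = a i + b i` at place `i` turns the `i`-th
term into `P i + P (i+1)`, so the sum telescopes modulo two. -/
theorem sum_prod_telescope {n : ℕ} (a b : Fin n → ZMod 2) (hab : ∀ i, a i + b i = 1) :
    ∑ i, ∏ j, (if j < i then a j else if j = i then 1 else b j) = ∏ j, a j + ∏ j, b j := by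
  induction n with
  | zero => simp [CharTwo.add_self_eq_zero]
  | succ n ih =>
    have ih' := ih (fun i => a i.castSucc) (fun i => b i.castSucc) (fun i => hab _)
    have hlast : b (Fin.last n) = a (Fin.last n) + 1 := by
      rw [← hab (Fin.last n), ← add_assoc, CharTwo.add_self_eq_zero, zero_add]
    rw [Fin.sum_univ_castSucc]
    simp only [Fin.prod_univ_castSucc, Fin.castSucc_lt_castSucc_iff, Fin.castSucc_inj,
      Fin.castSucc_lt_last, if_true, lt_irrefl, if_false, mul_one]
    have h1 : ∀ i : Fin n, ¬ Fin.last n < i.castSucc := fun i => not_lt.2 (Fin.le_last _)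
    have h2 : ∀ i : Fin n, Fin.last n ≠ i.castSucc := fun i => (Fin.castSucc_lt_last i).ne'
    simp only [h1, h2, if_false, ← Finset.sum_mul]
    rw [ih', hlast]
    have h3 : (2 : ZMod 2) = 0 := by decide
    linear_combination (∏ i : Fin n, a i.castSucc) * h3

theorem image_erase_eq_image_succAbove {m : ℕ} (l : Fin (m + 1) → ℤ) (i : Fin (m + 1)) :
    (Finset.univ.erase i).image l = Finset.univ.image (fun j => l (i.succAbove j)) := by
  ext x
  simp only [Finset.mem_image, Finset.mem_erase, Finset.mem_univ, and_true, true_and]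
  constructor
  · rintro ⟨j, hj, rfl⟩
    obtain ⟨k, rfl⟩ := Fin.exists_succAbove_eq hj
    exact ⟨k, rfl⟩
  · rintro ⟨k, rfl⟩
    exact ⟨_, Fin.succAbove_ne i k, rfl⟩

theorem altIndicator_image {m : ℕ} {l : Fin m → ℤ} (hl : StrictMono fun i => |l i|) :
    altIndicator m (Finset.univ.image l) =
      ∏ i : Fin m, if 0 < (-1) ^ (i : ℕ) * l i then (1 : ZMod 2) else 0 := by
  rw [Finset.prod_ite_zero, altIndicator]
  simp [alternatingPos_image_iff hl]

/-- Entries after `i` move down one place, so the sign demanded of them reverses. -/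
theorem altIndicator_image_erase {m : ℕ} {l : Fin (m + 1) → ℤ} (hl : StrictMono fun i => |l i|)
    (i : Fin (m + 1)) :
    altIndicator m ((Finset.univ.erase i).image l) =
      ∏ j, (if j < i then (if 0 < (-1) ^ (j : ℕ) * l j then (1 : ZMod 2) else 0) else
        if j = i then 1 else if 0 < (-1) ^ (j : ℕ) * -l j then 1 else 0) := by
  rw [image_erase_eq_image_succAbove,
    altIndicator_image (hl.comp (Fin.strictMono_succAbove i) :
      StrictMono fun j => |l (i.succAbove j)|), Fin.prod_univ_succAbove _ i]
  simp only [lt_irrefl, if_false, if_true, one_mul, Fin.succAbove_ne]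
  refine Finset.prod_congr rfl fun j _ => ?_
  by_cases h : j.castSucc < i
  · rw [Fin.succAbove_of_castSucc_lt _ _ h]
    simp [h]
  · have h' : ¬ j.succ < i := fun h2 => h (lt_trans (Fin.castSucc_lt_succ) h2)
    rw [Fin.succAbove_of_le_castSucc _ _ (not_lt.1 h)]
    simp [h', pow_succ]

theorem sum_altIndicator_of_strictMono {m : ℕ} {l : Fin (m + 1) → ℤ}
    (hl : StrictMono fun i => |l i|) (h0 : ∀ i, l i ≠ 0) :
    ∑ i, altIndicator m ((Finset.univ.erase i).image l) =
      altIndicator (m + 1) (Finset.univ.image l) +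
        altIndicator (m + 1) (Finset.univ.image fun i => -l i) := by
  have hl' : StrictMono fun i => |-l i| := by simpa using hl
  simp only [altIndicator_image_erase hl, altIndicator_image hl, altIndicator_image hl']
  refine sum_prod_telescope _ _ fun i => ?_
  have hne : (-1) ^ (i : ℕ) * l i ≠ 0 := mul_ne_zero (by simp) (h0 i)
  rw [mul_neg]
  rcases lt_or_gt_of_ne hne with h | h
  · rw [if_neg h.not_gt, if_pos (neg_pos.2 h), zero_add]
  · rw [if_pos h, if_neg (by simpa using h.le), add_zero]

/-- Among the facets of a simplex without complementary labels, the number of those with positive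
alternating labels is odd if and only if the labels of the simplex alternate. -/
theorem sum_altIndicator_erase {m : ℕ} (l : Fin (m + 1) → ℤ) (hl : ∀ i j, l i ≠ -l j) :
    ∑ i, altIndicator m ((Finset.univ.erase i).image l) =
      altIndicator (m + 1) (Finset.univ.image l) +
        altIndicator (m + 1) (Finset.univ.image fun i => -l i) := by
  by_cases hinj : Function.Injective l
  · have habs : Function.Injective fun i => |l i| := fun i j h =>
      (abs_eq_abs.1 h).elim (fun h => hinj h) (fun h => (hl i j h).elim)
    let τ := Tuple.sort fun i => |l i|
    have hτ : StrictMono fun i => |l (τ i)| :=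
      (Tuple.monotone_sort fun i => |l i|).strictMono_of_injective (habs.comp τ.injective)
    have key := sum_altIndicator_of_strictMono hτ fun i h => hl (τ i) (τ i) (by simp [h])
    have himg : ∀ (f : Fin (m + 1) → ℤ),
        Finset.univ.image (fun i => f (τ i)) = Finset.univ.image f := fun f => by
      have h := Finset.image_image (s := Finset.univ) (f := τ) (g := f)
      rw [Finset.image_univ_of_surjective τ.surjective] at h
      exact h.symm
    rw [himg l, himg fun i => -l i] at key
    rw [← key, ← Equiv.sum_comp τ]
    refine Finset.sum_congr rfl fun i _ => ?_
    congr 1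
    ext x
    simp only [Finset.mem_image, Finset.mem_erase, Finset.mem_univ, and_true]
    constructor
    · rintro ⟨j, hj, rfl⟩
      exact ⟨τ.symm j, fun h => hj (by rw [← h]; simp), by simp⟩
    · rintro ⟨j, hj, rfl⟩
      exact ⟨τ j, fun h => hj (τ.injective h), rfl⟩
  · have hz : ∀ f : Fin (m + 1) → ℤ, ¬ Function.Injective f →
        altIndicator (m + 1) (Finset.univ.image f) = 0 := fun f hf => by
      refine if_neg fun h => hf ?_
      have h1 : Set.InjOn f (Finset.univ : Finset (Fin (m + 1))) := by
        rw [← Finset.card_image_iff, h.card, Finset.card_fin]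
      simpa [Set.injOn_univ] using h1
    rw [hz l hinj, hz _ fun h => hinj fun i j hij => h (by simp [hij]), add_zero]
    obtain ⟨i, j, hij, hne⟩ := Function.not_injective_iff.1 hinj
    -- With `l i = l j`, a facet keeping both has too few labels, while the facets omitting `i` or
    -- `j` have the same label set and cancel.
    have h1 : ∀ x, x ≠ i → x ≠ j → altIndicator m ((Finset.univ.erase x).image l) = 0 := by
      intro x hxi hxj
      refine if_neg fun h => ?_
      have hc := h.card
      have h2 : Set.InjOn l (Finset.univ.erase x) := by
        rw [← Finset.card_image_iff, hc]; simp
      exact hne (h2 (by simpa using hxi.symm) (by simpa using hxj.symm) hij)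
    have h2 : (Finset.univ.erase i).image l = (Finset.univ.erase j).image l := by
      ext x
      simp only [Finset.mem_image, Finset.mem_erase, Finset.mem_univ, and_true]
      constructor
      · rintro ⟨y, hy, rfl⟩
        by_cases hyj : y = j
        · exact ⟨i, hne, by rw [hyj, hij]⟩
        · exact ⟨y, hyj, rfl⟩
      · rintro ⟨y, hy, rfl⟩
        by_cases hyi : y = i
        · exact ⟨j, hne.symm, by rw [hyi, hij]⟩
        · exact ⟨y, hyi, rfl⟩
    rw [Finset.sum_eq_add i j hne (fun x _ hx => h1 x hx.1 hx.2) (by simp) (by simp), h2,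
      CharTwo.add_self_eq_zero]

/-! ### Sign vectors and their maximal chains -/

/-- A nonzero sign vector in `{+, -, 0} ^ n`, given as the set of its signed coordinates. -/
def IsSignVector (n : ℕ) (X : Finset ℤ) : Prop :=
  X.Nonempty ∧ (∀ x ∈ X, x ≠ 0 ∧ |x| ≤ (n : ℤ)) ∧ ∀ x ∈ X, -x ∉ X

theorem mem_negSet {A : Finset ℤ} {x : ℤ} : x ∈ negSet A ↔ -x ∈ A := by
  simp only [negSet, Finset.mem_image]
  exact ⟨fun ⟨a, ha, h⟩ => by rwa [← h, neg_neg], fun h => ⟨-x, h, neg_neg x⟩⟩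

theorem negSet_negSet (A : Finset ℤ) : negSet (negSet A) = A := by
  ext x; simp [mem_negSet]

theorem negSet_subset_negSet {A B : Finset ℤ} : negSet A ⊆ negSet B ↔ A ⊆ B := by
  constructor
  · intro h x hx
    have := @h (-x) (mem_negSet.2 (by simpa using hx))
    simpa [mem_negSet] using this
  · intro h x hx
    exact mem_negSet.2 (h (mem_negSet.1 hx))

theorem IsSignVector.neg {n : ℕ} {X : Finset ℤ} (h : IsSignVector n X) :
    IsSignVector n (negSet X) := by
  obtain ⟨⟨x, hx⟩, h1, h2⟩ := h
  refine ⟨⟨-x, mem_negSet.2 (by simpa using hx)⟩, fun y hy => ?_, fun y hy hy' => ?_⟩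
  · simpa using h1 _ (mem_negSet.1 hy)
  · rw [mem_negSet] at hy hy'
    exact h2 _ hy hy'

/-- The signed permutations of `1, …, d`; they encode the maximal chains of nonzero sign vectors in
`{+, -, 0} ^ d`. -/
noncomputable def signedPerms (d : ℕ) : Finset (Fin d → ℤ) :=
  open Classical in
  (Fintype.piFinset fun _ => Finset.Icc (-d : ℤ) d).filter
    fun w => Function.Injective (fun i => |w i|) ∧ ∀ i, w i ≠ 0

theorem mem_signedPerms {d : ℕ} {w : Fin d → ℤ} :
    w ∈ signedPerms d ↔ Function.Injective (fun i => |w i|) ∧ ∀ i, w i ≠ 0 ∧ |w i| ≤ (d : ℤ) := by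
  simp only [signedPerms, Finset.mem_filter, Fintype.mem_piFinset, Finset.mem_Icc, ← abs_le]
  exact ⟨fun h => ⟨h.2.1, fun i => ⟨h.2.2 i, h.1 i⟩⟩,
    fun h => ⟨fun i => (h.2 i).2, h.1, fun i => (h.2 i).1⟩⟩

theorem exists_abs_eq_of_mem_signedPerms {d : ℕ} {w : Fin (d + 1) → ℤ}
    (hw : w ∈ signedPerms (d + 1)) : ∃ i, |w i| = (d : ℤ) + 1 := by
  obtain ⟨hinj, hb⟩ := mem_signedPerms.1 hw
  have h : Finset.univ.image (fun i => |w i|) = Finset.Icc (1 : ℤ) (d + 1) := by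
    refine Finset.eq_of_subset_of_card_le (fun x hx => ?_) ?_
    · obtain ⟨i, -, rfl⟩ := Finset.mem_image.1 hx
      have h1 := (hb i).2
      push_cast at h1
      exact Finset.mem_Icc.2 ⟨Int.one_le_abs (hb i).1, h1⟩
    · rw [Finset.card_image_of_injective _ hinj]
      simp
  have h2 : (d : ℤ) + 1 ∈ Finset.Icc (1 : ℤ) (d + 1) := by simp
  rw [← h] at h2
  simpa using h2

/-- The `j`-th sign vector of the chain encoded by `w`. -/
def prefixSet {d : ℕ} (w : Fin d → ℤ) (j : Fin d) : Finset ℤ := (Finset.Iic j).image w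

theorem prefixSet_mono {d : ℕ} (w : Fin d → ℤ) {i j : Fin d} (h : i ≤ j) :
    prefixSet w i ⊆ prefixSet w j :=
  Finset.image_subset_image (Finset.Iic_subset_Iic.2 h)

theorem prefixSet_neg {d : ℕ} (w : Fin d → ℤ) (j : Fin d) :
    prefixSet (-w) j = negSet (prefixSet w j) := by
  simp only [prefixSet, negSet, Finset.image_image]
  rfl

theorem isSignVector_prefixSet {n d : ℕ} (hd : d ≤ n) {w : Fin d → ℤ} (hw : w ∈ signedPerms d)
    (j : Fin d) : IsSignVector n (prefixSet w j) := by
  obtain ⟨hinj, hb⟩ := mem_signedPerms.1 hw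
  refine ⟨⟨w j, Finset.mem_image_of_mem _ (Finset.mem_Iic.2 le_rfl)⟩, fun x hx => ?_,
    fun x hx hx' => ?_⟩
  · obtain ⟨i, -, rfl⟩ := Finset.mem_image.1 hx
    exact ⟨(hb i).1, (hb i).2.trans (by exact_mod_cast hd)⟩
  · obtain ⟨i, -, rfl⟩ := Finset.mem_image.1 hx
    obtain ⟨i', -, h⟩ := Finset.mem_image.1 hx'
    have h2 : i' = i := hinj (by simp [h])
    subst h2
    have := (hb i').1
    omega

theorem prefixSet_comp_swap {d : ℕ} (w : Fin (d + 1) → ℤ) (i : Fin d) {j : Fin (d + 1)}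
    (hj : j ≠ i.castSucc) :
    prefixSet (w ∘ Equiv.swap i.castSucc i.succ) j = prefixSet w j := by
  have hle : ∀ a, a ≤ j → Equiv.swap i.castSucc i.succ a ≤ j := by
    intro a ha
    rw [Equiv.swap_apply_def]
    have hj' : (j : ℕ) ≠ i := fun h => hj (Fin.ext h)
    split_ifs with h1 h2
    · subst h1
      simp only [Fin.le_def, Fin.val_castSucc, Fin.val_succ] at *
      omega
    · subst h2
      simp only [Fin.le_def, Fin.val_castSucc, Fin.val_succ] at *
      omega
    · exact ha
  ext x
  simp only [prefixSet, Finset.mem_image, Finset.mem_Iic, Function.comp_apply]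
  exact ⟨fun ⟨a, ha, h⟩ => ⟨_, hle a ha, h⟩, fun ⟨a, ha, h⟩ => ⟨_, hle a ha, by simpa using h⟩⟩

theorem prefixSet_castSucc {d : ℕ} (w : Fin (d + 1) → ℤ) (j : Fin d) :
    prefixSet w j.castSucc = prefixSet (Fin.init w) j := by
  ext x
  simp only [prefixSet, Finset.mem_image, Finset.mem_Iic]
  constructor
  · rintro ⟨a, ha, rfl⟩
    have h : (a : ℕ) < d := lt_of_le_of_lt (Fin.le_def.1 ha) j.2
    exact ⟨⟨a, h⟩, ha, rfl⟩
  · rintro ⟨a, ha, rfl⟩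
    exact ⟨a.castSucc, ha, rfl⟩

/-! ### Tucker's lemma by a parity count -/

section Tucker

variable (lab : Finset ℤ → ℤ)

/-- The number, modulo two, of the maximal chains in `{+, -, 0} ^ d` with positive alternating
labels. -/
noncomputable def alternatingChains (d : ℕ) : ZMod 2 :=
  ∑ w ∈ signedPerms d, altIndicator d (Finset.univ.image fun j => lab (prefixSet w j))

/-- The maximal chains of the upper hemisphere. -/
noncomputable def upperPerms (d : ℕ) : Finset (Fin (d + 1) → ℤ) :=
  open Classical in (signedPerms (d + 1)).filter fun w => ∃ i, w i = (d : ℤ) + 1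

theorem mem_upperPerms {d : ℕ} {w : Fin (d + 1) → ℤ} :
    w ∈ upperPerms d ↔ w ∈ signedPerms (d + 1) ∧ ∃ i, w i = (d : ℤ) + 1 := by
  simp [upperPerms]

theorem neg_mem_signedPerms {d : ℕ} {w : Fin d → ℤ} (hw : w ∈ signedPerms d) :
    -w ∈ signedPerms d := by
  rw [mem_signedPerms] at hw ⊢
  simpa using hw

theorem neg_mem_upperPerms_iff {d : ℕ} {w : Fin (d + 1) → ℤ} (hw : w ∈ signedPerms (d + 1)) :
    -w ∈ upperPerms d ↔ w ∉ upperPerms d := by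
  obtain ⟨i, hi⟩ := exists_abs_eq_of_mem_signedPerms hw
  simp only [mem_upperPerms, hw, neg_mem_signedPerms hw, true_and, Pi.neg_apply]
  constructor
  · rintro ⟨j, hj⟩ ⟨k, hk⟩
    have hjk : j = k := (mem_signedPerms.1 hw).1 (by
      show |w j| = |w k|
      rw [hk, ← hj, abs_neg])
    subst hjk
    omega
  · intro h
    refine ⟨i, ?_⟩
    rcases (abs_eq (by omega : (0 : ℤ) ≤ d + 1)).1 hi with h1 | h1
    · exact (h ⟨i, h1⟩).elim
    · omega

/-- The antipodal map exchanges the hemispheres and negates labels, so negatively alternating upper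
chains correspond to positively alternating lower ones. -/
theorem sum_upperPerms_add_neg {n d : ℕ} (hd : d + 1 ≤ n)
    (hanti : ∀ X, IsSignVector n X → lab (negSet X) = -lab X) :
    ∑ w ∈ upperPerms d, (altIndicator (d + 1) (Finset.univ.image fun j => lab (prefixSet w j)) +
      altIndicator (d + 1) (Finset.univ.image fun j => -lab (prefixSet w j))) =
      alternatingChains lab (d + 1) := by
  classical
  rw [Finset.sum_add_distrib, alternatingChains,
    ← Finset.sum_filter_add_sum_filter_not (signedPerms (d + 1)) (· ∈ upperPerms d)]
  congr 1
  · refine Finset.sum_congr ?_ fun _ _ => rfl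
    ext w
    simp only [Finset.mem_filter, mem_upperPerms]
    tauto
  · refine Finset.sum_nbij' (fun w => -w) (fun w => -w) ?_ ?_ ?_ ?_ ?_
    · intro w hw
      have h := (mem_upperPerms.1 hw).1
      refine Finset.mem_filter.2 ⟨neg_mem_signedPerms h, ?_⟩
      rw [← neg_mem_upperPerms_iff (neg_mem_signedPerms h), neg_neg]
      exact hw
    · intro w hw
      obtain ⟨h1, h2⟩ := Finset.mem_filter.1 hw
      exact (neg_mem_upperPerms_iff h1).2 h2
    · simp
    · simp
    · intro w hw
      have h := (mem_upperPerms.1 hw).1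
      congr 1
      refine Finset.image_congr fun j _ => ?_
      simp only [prefixSet_neg]
      exact (hanti _ (isSignVector_prefixSet hd h j)).symm

/-- A chain with a non-maximal member removed has exactly two completions, which differ by swapping
two adjacent entries and lie in the same hemisphere. Such facets cancel. -/
theorem sum_upperPerms_erase_castSucc {d : ℕ} (i : Fin d) :
    ∑ w ∈ upperPerms d, altIndicator d
      ((Finset.univ.erase i.castSucc).image fun j => lab (prefixSet w j)) = 0 := by
  refine Finset.sum_involution (fun w _ => w ∘ Equiv.swap i.castSucc i.succ) ?_ ?_ ?_ ?_
  · intro w _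
    have h : ((Finset.univ.erase i.castSucc).image fun j =>
        lab (prefixSet (w ∘ Equiv.swap i.castSucc i.succ) j)) =
        (Finset.univ.erase i.castSucc).image fun j => lab (prefixSet w j) :=
      Finset.image_congr fun j hj => by
        simp only [prefixSet_comp_swap w i (Finset.ne_of_mem_erase hj)]
    rw [h, CharTwo.add_self_eq_zero]
  · intro w hw _ h
    have h1 := congrFun h i.castSucc
    simp only [Function.comp_apply, Equiv.swap_apply_left] at h1
    have h2 := (mem_signedPerms.1 (mem_upperPerms.1 hw).1).1 (congrArg (fun x => |x|) h1)
    exact (Fin.castSucc_lt_succ (i := i)).ne' h2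
  · intro w hw
    obtain ⟨h1, k, hk⟩ := mem_upperPerms.1 hw
    obtain ⟨h2, h3⟩ := mem_signedPerms.1 h1
    exact mem_upperPerms.2 ⟨mem_signedPerms.2 ⟨h2.comp (Equiv.injective _), fun i => h3 _⟩,
      Equiv.swap i.castSucc i.succ k, by simpa using hk⟩
  · intro w _
    funext x
    simp

/-- Facets missing the top member cancel in the interior of the hemisphere; those left lie on the
equator, the sphere one dimension lower. -/
theorem sum_upperPerms_erase_last (d : ℕ) :
    ∑ w ∈ upperPerms d, altIndicator d
      ((Finset.univ.erase (Fin.last d)).image fun j => lab (prefixSet w j)) =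
      alternatingChains lab d := by
  classical
  have hlabels : ∀ w : Fin (d + 1) → ℤ,
      ((Finset.univ.erase (Fin.last d)).image fun j => lab (prefixSet w j)) =
        Finset.univ.image fun j => lab (prefixSet (Fin.init w) j) := fun w => by
    rw [image_erase_eq_image_succAbove]
    simp only [Fin.succAbove_last, prefixSet_castSucc]
  simp only [hlabels]
  rw [← Finset.sum_filter_add_sum_filter_not (upperPerms d) (fun w => w (Fin.last d) = (d : ℤ) + 1),
    alternatingChains]
  -- Here `d + 1` occurs before the last place, so changing the last sign stays in the hemisphere
  -- and keeps the facet.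
  have hzero : ∑ w ∈ (upperPerms d).filter (fun w => ¬ w (Fin.last d) = (d : ℤ) + 1),
      altIndicator d (Finset.univ.image fun j => lab (prefixSet (Fin.init w) j)) = 0 := by
    refine Finset.sum_involution
      (fun w _ => Function.update w (Fin.last d) (-w (Fin.last d))) ?_ ?_ ?_ ?_
    · intro w _
      simp only [Fin.init_update_last, CharTwo.add_self_eq_zero]
    · intro w hw _ h
      have h1 := congrFun h (Fin.last d)
      simp only [Function.update_self] at h1
      have h2 := ((mem_signedPerms.1 (mem_upperPerms.1 (Finset.mem_filter.1 hw).1).1).2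
        (Fin.last d)).1
      omega
    · intro w hw
      obtain ⟨hw1, hw2⟩ := Finset.mem_filter.1 hw
      obtain ⟨h1, k, hk⟩ := mem_upperPerms.1 hw1
      obtain ⟨h2, h3⟩ := mem_signedPerms.1 h1
      have hkl : k ≠ Fin.last d := fun h => hw2 (h ▸ hk)
      have habs : ∀ i, |Function.update w (Fin.last d) (-w (Fin.last d)) i| = |w i| := by
        intro i
        rcases eq_or_ne i (Fin.last d) with rfl | hi
        · simp
        · rw [Function.update_of_ne hi]
      refine Finset.mem_filter.2 ⟨mem_upperPerms.2 ⟨mem_signedPerms.2 ⟨?_, fun i => ?_⟩, k, ?_⟩, ?_⟩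
      · simpa only [habs] using h2
      · rw [habs, ← abs_pos, habs, abs_pos]
        exact h3 i
      · rw [Function.update_of_ne hkl, hk]
      · rw [Function.update_self]
        intro h
        exact hkl (h2 (by
          show |w k| = |w (Fin.last d)|
          rw [hk, ← h, abs_neg]))
    · intro w _
      simp
  rw [hzero, add_zero]
  refine Finset.sum_nbij' (fun w => Fin.init w)
    (fun w => Fin.snoc (α := fun _ => ℤ) w ((d : ℤ) + 1)) ?_ ?_ ?_ ?_ ?_
  · intro w hw
    obtain ⟨hw1, hw2⟩ := Finset.mem_filter.1 hw
    obtain ⟨h2, h3⟩ := mem_signedPerms.1 (mem_upperPerms.1 hw1).1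
    refine mem_signedPerms.2 ⟨h2.comp (Fin.castSucc_injective d), fun i => ⟨(h3 _).1, ?_⟩⟩
    have h4 := (h3 i.castSucc).2
    have h5 : |w i.castSucc| ≠ |w (Fin.last d)| := fun h => (Fin.castSucc_lt_last i).ne (h2 h)
    rw [hw2, abs_of_nonneg (by omega : (0 : ℤ) ≤ d + 1)] at h5
    push_cast at h4
    show |w i.castSucc| ≤ d
    omega
  · intro w hw
    obtain ⟨h2, h3⟩ := mem_signedPerms.1 hw
    have h1 : ∀ x : Fin d, |w x| ≠ |(d : ℤ) + 1| := fun x => by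
      have := (h3 x).2
      rw [abs_of_nonneg (by omega : (0 : ℤ) ≤ d + 1)]
      omega
    refine Finset.mem_filter.2 ⟨mem_upperPerms.2 ⟨mem_signedPerms.2 ⟨?_, ?_⟩, Fin.last d, ?_⟩, ?_⟩
    · intro a b
      refine Fin.lastCases ?_ (fun a => ?_) a <;> refine Fin.lastCases ?_ (fun b => ?_) b
      · simp
      · intro h
        simp only [Fin.snoc_last, Fin.snoc_castSucc] at h
        exact (h1 b h.symm).elim
      · intro h
        simp only [Fin.snoc_last, Fin.snoc_castSucc] at h
        exact (h1 a h).elim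
      · intro h
        simp only [Fin.snoc_castSucc] at h
        rw [h2 h]
    · intro a
      refine Fin.lastCases ?_ (fun a => ?_) a
      · rw [Fin.snoc_last]
        push_cast
        exact ⟨by omega, (abs_of_nonneg (by omega)).le⟩
      · rw [Fin.snoc_castSucc]
        refine ⟨(h3 a).1, (h3 a).2.trans (by push_cast; omega)⟩
    · simp
    · simp
  · intro w hw
    have h := (Finset.mem_filter.1 hw).2
    show Fin.snoc (α := fun _ => ℤ) (Fin.init w) ((d : ℤ) + 1) = w
    rw [← h]
    exact Fin.snoc_init_self w
  · intro w _
    exact Fin.init_snoc _ _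
  · intro w _
    rfl

/-- Count positive alternating facets over the upper hemisphere. By simplices this gives the chains
of dimension `d + 1`, by facets those of dimension `d`. The induction starts from the empty chain.
-/
theorem alternatingChains_eq_one {n : ℕ}
    (hanti : ∀ X, IsSignVector n X → lab (negSet X) = -lab X)
    (hcomp : ∀ X Y, IsSignVector n X → IsSignVector n Y → X ⊆ Y → lab X ≠ -lab Y) :
    ∀ d ≤ n, alternatingChains lab d = 1 := by
  intro d
  induction d with
  | zero =>
    intro _
    have h1 : signedPerms 0 = {Fin.elim0} := by
      ext w
      rw [mem_signedPerms, Finset.mem_singleton]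
      exact ⟨fun _ => Subsingleton.elim _ _, fun _ => ⟨fun i => i.elim0, fun i => i.elim0⟩⟩
    rw [alternatingChains, h1, Finset.sum_singleton]
    exact if_pos ⟨Fin.elim0, fun i => i.elim0, fun i => i.elim0, by simp⟩
  | succ d ih =>
    intro hd
    rw [← ih (by omega), ← sum_upperPerms_add_neg lab hd hanti, ← sum_upperPerms_erase_last]
    have h1 : ∀ w ∈ upperPerms d,
        altIndicator (d + 1) (Finset.univ.image fun j => lab (prefixSet w j)) +
          altIndicator (d + 1) (Finset.univ.image fun j => -lab (prefixSet w j)) =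
        ∑ i, altIndicator d ((Finset.univ.erase i).image fun j => lab (prefixSet w j)) := by
      intro w hw
      have hv := isSignVector_prefixSet hd (mem_upperPerms.1 hw).1
      refine (sum_altIndicator_erase _ fun i j h => ?_).symm
      rcases le_total i j with hij | hij
      · exact hcomp _ _ (hv i) (hv j) (prefixSet_mono w hij) h
      · exact hcomp _ _ (hv j) (hv i) (prefixSet_mono w hij) (by rw [h, neg_neg])
    rw [Finset.sum_congr rfl h1, Finset.sum_comm, Fin.sum_univ_castSucc,
      Finset.sum_eq_zero fun i _ => sum_upperPerms_erase_castSucc lab i, zero_add]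

/-- Tucker's lemma for the barycentric subdivision of the cross-polytope: an antipodal labelling
of the nonzero sign vectors without complementary comparable pairs needs a label of absolute value
at least `n`. -/
theorem exists_le_abs_label {n : ℕ} (hn : 1 ≤ n)
    (hanti : ∀ X, IsSignVector n X → lab (negSet X) = -lab X)
    (hcomp : ∀ X Y, IsSignVector n X → IsSignVector n Y → X ⊆ Y → lab X ≠ -lab Y) :
    ∃ X, IsSignVector n X ∧ (n : ℤ) ≤ |lab X| := by
  by_contra! hlt
  have h1 := alternatingChains_eq_one lab hanti hcomp n le_rfl
  obtain ⟨w, hw, hne⟩ := Finset.exists_ne_zero_of_sum_ne_zero (h1.trans_ne one_ne_zero)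
  have halt : AlternatingPos n (Finset.univ.image fun j => lab (prefixSet w j)) := by
    by_contra h
    exact hne (if_neg h)
  -- An alternating chain has `n` distinct absolute labels, too many for `1, …, n - 1`. Nonzero
  -- labels come from `hcomp` with `X = Y`.
  have hsub : (Finset.univ.image fun j => lab (prefixSet w j)).image (fun x => |x|) ⊆
      Finset.Icc (1 : ℤ) (n - 1) := by
    intro x hx
    obtain ⟨y, hy, rfl⟩ := Finset.mem_image.1 hx
    obtain ⟨j, -, rfl⟩ := Finset.mem_image.1 hy
    have hv := isSignVector_prefixSet le_rfl hw j
    have h0 : lab (prefixSet w j) ≠ 0 := fun h =>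
      hcomp _ _ hv hv (Finset.Subset.refl _) (by rw [h, neg_zero])
    exact Finset.mem_Icc.2 ⟨Int.one_le_abs h0, Int.le_sub_one_of_lt (hlt _ hv)⟩
  have hcard := Finset.card_le_card hsub
  rw [halt.card_image_abs, Int.card_Icc] at hcard
  omega

end Tucker

/-! ### Longest alternating subsets as labels -/

theorem AlternatingPos.exists_subset {m k : ℕ} {S : Finset ℤ} (h : AlternatingPos m S)
    (hk : k ≤ m) : ∃ A ⊆ S, AlternatingPos k A := by
  obtain ⟨b, hb, hs, rfl⟩ := h
  refine ⟨Finset.univ.image fun i => b (Fin.castLE hk i), fun x hx => ?_,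
    fun i => b (Fin.castLE hk i), fun i j hij => hb hij, fun i => hs (Fin.castLE hk i), rfl⟩
  obtain ⟨i, -, rfl⟩ := Finset.mem_image.1 hx
  exact Finset.mem_image_of_mem b (Finset.mem_univ _)

open Classical in
/-- The largest size of an alternating subset of `X` whose element of least absolute value is
positive. -/
noncomputable def altLength (X : Finset ℤ) : ℕ :=
  Nat.findGreatest (fun m => ∃ B ⊆ X, AlternatingPos m B) X.card

theorem le_altLength {m : ℕ} {X B : Finset ℤ} (hB : B ⊆ X) (h : AlternatingPos m B) :
    m ≤ altLength X := by
  classical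
  exact Nat.le_findGreatest (h.card ▸ Finset.card_le_card hB) ⟨B, hB, h⟩

theorem exists_alternatingPos_altLength (X : Finset ℤ) :
    ∃ B ⊆ X, AlternatingPos (altLength X) B := by
  classical
  refine Nat.findGreatest_spec (P := fun m => ∃ B ⊆ X, AlternatingPos m B) (Nat.zero_le _) ?_
  exact ⟨∅, Finset.empty_subset _, Fin.elim0, fun i => i.elim0, fun i => i.elim0, by simp⟩

theorem altLength_mono {X Y : Finset ℤ} (h : X ⊆ Y) : altLength X ≤ altLength Y := by
  obtain ⟨B, hB, hB'⟩ := exists_alternatingPos_altLength X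
  exact le_altLength (hB.trans h) hB'

/-- An alternating subset of `X` starting with a negative element can be extended by putting the
positive minimum `x` in front. -/
theorem altLength_negSet_lt {n : ℕ} {X : Finset ℤ} (hX : IsSignVector n X) {x : ℤ} (hx : x ∈ X)
    (hpos : 0 < x) (hmin : ∀ y ∈ X, x ≤ |y|) : altLength (negSet X) < altLength X := by
  obtain ⟨B, hB, b, hb, hs, rfl⟩ := exists_alternatingPos_altLength (negSet X)
  have hmem : ∀ i, -b i ∈ X := fun i =>
    mem_negSet.1 (hB (Finset.mem_image_of_mem b (Finset.mem_univ i)))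
  have hlt : ∀ i, x < |b i| := by
    intro i
    have h0 : ∀ j : Fin (altLength (negSet X)), (j : ℕ) = 0 → x < |b j| := by
      intro j hj
      have h1 := hs j
      rw [hj, pow_zero, one_mul] at h1
      have h2 := hmin _ (hmem j)
      rw [abs_neg] at h2
      refine lt_of_le_of_ne h2 fun h => hX.2.2 x hx ?_
      rw [h, abs_of_pos h1]
      exact hmem j
    rcases Nat.eq_zero_or_pos (i : ℕ) with hi | hi
    · exact h0 i hi
    · exact (h0 ⟨0, by omega⟩ rfl).trans (hb (Fin.lt_def.2 hi))
  have hcons : AlternatingPos (altLength (negSet X) + 1)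
      (Finset.univ.image (Fin.cons (α := fun _ => ℤ) x fun i => -b i)) := by
    refine ⟨_, ?_, ?_, rfl⟩
    · intro i j
      refine Fin.cases ?_ (fun i => ?_) i <;> refine Fin.cases ?_ (fun j => ?_) j
      · simp
      · intro _
        simpa [abs_of_pos hpos] using hlt j
      · intro h
        exact absurd h (by simp)
      · intro h
        simpa using hb (Fin.succ_lt_succ_iff.1 h)
    · intro i
      refine Fin.cases ?_ (fun i => ?_) i
      · simpa using hpos
      · simpa [pow_succ] using hs i
  refine Nat.lt_of_succ_le (le_altLength (fun y hy => ?_) hcons)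
  obtain ⟨i, -, rfl⟩ := Finset.mem_image.1 hy
  refine Fin.cases ?_ (fun i => ?_) i
  · simpa using hx
  · simpa using hmem i

theorem altLength_ne_altLength_negSet {n : ℕ} {X : Finset ℤ} (hX : IsSignVector n X) :
    altLength X ≠ altLength (negSet X) := by
  obtain ⟨x, hx, hmin⟩ := X.exists_min_image (fun y => |y|) hX.1
  rcases lt_or_gt_of_ne (hX.2.1 x hx).1 with h | h
  · have h1 := altLength_negSet_lt hX.neg (x := -x) (mem_negSet.2 (by simpa using hx)) (by omega)
      fun y hy => by simpa [abs_of_neg h] using hmin _ (mem_negSet.1 hy)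
    rw [negSet_negSet] at h1
    exact h1.ne
  · exact (altLength_negSet_lt hX hx h fun y hy => by simpa [abs_of_pos h] using hmin y hy).ne'

/-- The length of a longest alternating subset of `X`, signed by its first sign. -/
noncomputable def altLabel (X : Finset ℤ) : ℤ :=
  if altLength (negSet X) < altLength X then altLength X else -altLength (negSet X)

theorem altLabel_negSet {n : ℕ} {X : Finset ℤ} (hX : IsSignVector n X) :
    altLabel (negSet X) = -altLabel X := by
  have h := altLength_ne_altLength_negSet hX
  unfold altLabel
  rw [negSet_negSet]
  split_ifs <;> omega

/-- Both lengths are monotone and the two lengths of one vector never tie, so equal absolute labels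
along `X ⊆ Y` cannot come with opposite signs. -/
theorem altLabel_ne {n : ℕ} {X Y : Finset ℤ} (hX : IsSignVector n X) (hY : IsSignVector n Y)
    (hXY : X ⊆ Y) : altLabel X ≠ -altLabel Y := by
  have h := altLength_ne_altLength_negSet hX
  have h' := altLength_ne_altLength_negSet hY
  have h1 := altLength_mono hXY
  have h2 := altLength_mono (negSet_subset_negSet.2 hXY)
  unfold altLabel
  split_ifs <;> omega

theorem abs_altLabel_lt {k : ℕ} {X : Finset ℤ}
    (h : ∀ A, A ⊆ X ∨ A ⊆ negSet X → ¬ AlternatingPos k A) : |altLabel X| < k := by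
  have key : ∀ Y, Y = X ∨ Y = negSet X → altLength Y < k := by
    intro Y hY
    by_contra! hk
    obtain ⟨B, hB, hB'⟩ := exists_alternatingPos_altLength Y
    obtain ⟨A, hA, hA'⟩ := hB'.exists_subset hk
    refine h A ?_ hA'
    rcases hY with rfl | rfl
    · exact Or.inl (hA.trans hB)
    · exact Or.inr (hA.trans hB)
  have h1 := key X (Or.inl rfl)
  have h2 := key (negSet X) (Or.inr rfl)
  unfold altLabel
  rw [abs_lt]
  split_ifs <;> omega

/-! ### The covering bound from Tucker's lemma -/

/-- The alternating `k`-subsets of `[n]` cannot be covered, up to sign, by `p ≤ n - k` families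
such that no sign vector contains both a member of a family and the negative of one. -/
theorem no_small_cover {n k p : ℕ} (hk : 1 ≤ k) (hp : p + k ≤ n) (F : ℕ → Finset ℤ → Prop)
    (hcover : ∀ A, AlternatingPos k A → (∀ a ∈ A, |a| ≤ (n : ℤ)) →
      ∃ c < p, F c A ∨ F c (negSet A))
    (hF : ∀ c X A B, IsSignVector n X → A ⊆ X → B ⊆ X → F c A → ¬ F c (negSet B)) : False := by
  classical
  let C : Finset ℤ → ℕ → Prop := fun X c => ∃ A ⊆ X, F c A
  have hCmono : ∀ {X Y c}, X ⊆ Y → C X c → C Y c := fun h ⟨A, hA, hA'⟩ => ⟨A, hA.trans h, hA'⟩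
  have hC : ∀ {X c}, IsSignVector n X → C X c → ¬ C (negSet X) c := by
    rintro X c hX ⟨A, hA, hA'⟩ ⟨B, hB, hB'⟩
    refine hF c X A (negSet B) hX hA ?_ hA' (by rwa [negSet_negSet])
    rw [← negSet_subset_negSet, negSet_negSet]
    exact hB
  -- `D X` is invariant under negation and increasing in `X`; the sign of the label comes from `C`,
  -- which by `hC` never holds for both `X` and `-X`.
  let D : Finset ℤ → Set ℕ := fun X => {c | c < p ∧ (C X c ∨ C (negSet X) c)}
  have hDneg : ∀ X, D (negSet X) = D X := fun X => by
    ext c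
    simp only [D, Set.mem_ofPred_eq, negSet_negSet, or_comm]
  have hDmono : ∀ {X Y}, X ⊆ Y → D X ⊆ D Y := fun h c hc =>
    ⟨hc.1, hc.2.imp (hCmono h) (hCmono (negSet_subset_negSet.2 h))⟩
  -- The shift by `k` separates colour labels from alternation labels, which are below `k` in
  -- absolute value by `hsmall`.
  let lab : Finset ℤ → ℤ := fun X =>
    if (D X).Nonempty then
      if C X (sInf (D X)) then (k : ℤ) + (sInf (D X) : ℕ) else -((k : ℤ) + (sInf (D X) : ℕ))
    else altLabel X
  have hsmall : ∀ X, IsSignVector n X → ¬ (D X).Nonempty → |altLabel X| < k := by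
    intro X hX hne
    refine abs_altLabel_lt fun A hA hA' => hne ?_
    have hAn : ∀ a ∈ A, |a| ≤ (n : ℤ) := fun a ha =>
      hA.elim (fun h => (hX.2.1 a (h ha)).2) fun h => (hX.neg.2.1 a (h ha)).2
    obtain ⟨c, hc, h⟩ := hcover A hA' hAn
    refine ⟨c, hc, ?_⟩
    rcases hA with hA | hA
    · exact h.imp (fun h => ⟨A, hA, h⟩) fun h => ⟨_, negSet_subset_negSet.2 hA, h⟩
    · refine h.symm.imp (fun h => ⟨negSet A, ?_, h⟩) fun h => ⟨A, hA, h⟩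
      rw [← negSet_subset_negSet, negSet_negSet]
      exact hA
  have hanti : ∀ X, IsSignVector n X → lab (negSet X) = -lab X := by
    intro X hX
    simp only [lab, hDneg]
    by_cases hne : (D X).Nonempty
    · rw [if_pos hne, if_pos hne]
      have h1 := (Nat.sInf_mem hne).2
      have h2 := hC (c := sInf (D X)) hX
      by_cases h : C X (sInf (D X))
      · rw [if_pos h, if_neg (h2 h)]
      · rw [if_neg h, if_pos (h1.resolve_left h), neg_neg]
    · rw [if_neg hne, if_neg hne, altLabel_negSet hX]
  have hcomp : ∀ X Y, IsSignVector n X → IsSignVector n Y → X ⊆ Y → lab X ≠ -lab Y := by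
    intro X Y hX hY hXY h
    simp only [lab] at h
    by_cases hneX : (D X).Nonempty
    · have hneY := hneX.mono (hDmono hXY)
      rw [if_pos hneX, if_pos hneY] at h
      have h1 := (Nat.sInf_mem hneX).2
      by_cases hCX : C X (sInf (D X)) <;> by_cases hCY : C Y (sInf (D Y))
      · rw [if_pos hCX, if_pos hCY] at h
        omega
      · rw [if_pos hCX, if_neg hCY] at h
        have heq : sInf (D X) = sInf (D Y) := by omega
        exact hCY (heq ▸ hCmono hXY hCX)
      · rw [if_neg hCX, if_pos hCY] at h
        have heq : sInf (D X) = sInf (D Y) := by omega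
        refine hC hY hCY (hCmono (negSet_subset_negSet.2 hXY) (heq ▸ h1.resolve_left hCX))
      · rw [if_neg hCX, if_neg hCY] at h
        omega
    · rw [if_neg hneX] at h
      by_cases hneY : (D Y).Nonempty
      · rw [if_pos hneY] at h
        have h1 := abs_lt.1 (hsmall X hX hneX)
        split_ifs at h <;> omega
      · rw [if_neg hneY] at h
        exact altLabel_ne hX hY hXY h
  obtain ⟨X, hX, hle⟩ := exists_le_abs_label lab (by omega) hanti hcomp
  by_cases hne : (D X).Nonempty
  · have h1 := (Nat.sInf_mem hne).1
    simp only [lab, if_pos hne] at hle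
    have h2 : |(k : ℤ) + (sInf (D X) : ℕ)| = k + (sInf (D X) : ℕ) := abs_of_nonneg (by omega)
    split_ifs at hle
    · omega
    · rw [abs_neg] at hle
      omega
  · simp only [lab, if_neg hne] at hle
    have := hsmall X hX hne
    omega

/-! ### Balance and potentials -/

namespace SignedGraph

variable {α β : Type*}

-- One factor per end also covers loops, where the two factors cancel.
open Classical in
theorem switchVertex_apply {G : Graph α β} (σ : β → ℤˣ) (v : α) {e : β} {A B : α}
    (h : G.IsLink e A B) :
    switchVertex G σ v e = σ e * ((if v = A then -1 else 1) * if v = B then -1 else 1) := by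
  have key : (∃ w, w ≠ v ∧ G.IsLink e v w) ↔ (v = A ∧ B ≠ v) ∨ (v = B ∧ A ≠ v) := by
    constructor
    · rintro ⟨w, hw, hl⟩
      rcases hl.eq_and_eq_or_eq_and_eq h with ⟨rfl, rfl⟩ | ⟨rfl, rfl⟩
      · exact Or.inl ⟨rfl, hw⟩
      · exact Or.inr ⟨rfl, hw⟩
    · rintro (⟨rfl, hB⟩ | ⟨rfl, hA⟩)
      · exact ⟨B, hB, h⟩
      · exact ⟨A, hA, h.symm⟩
  simp only [switchVertex, key]
  by_cases hA : v = A <;> by_cases hB : v = B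
  · subst hA; subst hB; simp
  · subst hA; simp [hB, Ne.symm hB]
  · subst hB; simp [hA, Ne.symm hA]
  · simp [hA, hB]

open Classical in
theorem foldl_switchVertex_apply {G : Graph α β} {e : β} {A B : α} (h : G.IsLink e A B)
    (l : List α) (σ : β → ℤˣ) :
    l.foldl (switchVertex G) σ e =
      σ e * ((l.map fun v => if v = A then (-1 : ℤˣ) else 1).prod *
        (l.map fun v => if v = B then (-1 : ℤˣ) else 1).prod) := by
  induction l generalizing σ with
  | nil => simp
  | cons v l ih =>
    rw [List.foldl_cons, ih, switchVertex_apply σ v h]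
    simp only [List.map_cons, List.prod_cons]
    ac_rfl

theorem Balanced.exists_potential {S : SignedGraph α β} (h : S.Balanced) :
    ∃ s : α → ℤˣ, ∀ e A B, S.graph.IsLink e A B → S.sign e = s A * s B := by
  classical
  obtain ⟨l, -, hl⟩ := h
  -- The potential of `A` is the parity of the number of times `A` is switched.
  refine ⟨fun A => (l.map fun v => if v = A then (-1 : ℤˣ) else 1).prod, fun e A B hAB => ?_⟩
  have h1 := hl e hAB.edge_mem
  rw [foldl_switchVertex_apply hAB, mul_eq_one_iff_eq_inv, Int.units_inv_eq_self] at h1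
  exact h1

/-- Switch once each vertex of potential `-1`; finiteness makes this a list. -/
theorem balanced_of_potential {S : SignedGraph α β} (hfin : S.graph.vertexSet.Finite)
    (s : α → ℤˣ) (h : ∀ e A B, S.graph.IsLink e A B → S.sign e = s A * s B) : S.Balanced := by
  classical
  let T : Finset α := hfin.toFinset.filter fun v => s v = -1
  refine ⟨T.toList, fun v hv => ?_, fun e he => ?_⟩
  · rw [Finset.mem_toList, Finset.mem_filter, Set.Finite.mem_toFinset] at hv
    exact hv.1
  · obtain ⟨A, B, hAB⟩ := S.graph.exists_isLink_of_mem_edgeSet he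
    have key : ∀ A ∈ S.graph.vertexSet,
        (T.toList.map fun v => if v = A then (-1 : ℤˣ) else 1).prod = s A := by
      intro A hA
      rw [Finset.prod_map_toList, Finset.prod_ite_eq']
      rcases Int.units_eq_one_or (s A) with hs | hs
      · rw [if_neg (by simp [T, hs]), hs]
      · rw [if_pos (by simp [T, hs, hA]), hs]
    rw [foldl_switchVertex_apply hAB, key A hAB.left_mem, key B hAB.right_mem, ← h e A B hAB,
      Int.units_mul_self]

end SignedGraph

/-! ### Vertices of the graph as positive alternating sets -/

theorem mem_vertexSet_hat {n k : ℕ} {A : Finset ℤ} :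
    A ∈ (schrijverSignedGraphHat n k).graph.vertexSet ↔
      (IsSignedSubset n k A ∧ IsAlternating n k A) ∧ FirstPositive A := Iff.rfl

theorem isLink_hat {n k : ℕ} {e : Sym2 (Finset ℤ) × ℤˣ} {A B : Finset ℤ} :
    (schrijverSignedGraphHat n k).graph.IsLink e A B ↔
      (e.1 = s(A, B) ∧ ((e.2 = 1 ∧ Disjoint A (negSet B)) ∨ (e.2 = -1 ∧ Disjoint A B))) ∧
        A ∈ (schrijverSignedGraphHat n k).graph.vertexSet ∧
        B ∈ (schrijverSignedGraphHat n k).graph.vertexSet := by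
  simp only [schrijverSignedGraphHat, schrijverSignedGraph, kneserSignedGraph, SignedGraph.induce,
    Graph.induce, Set.mem_ofPred_eq]
  tauto

theorem abs_neg_one_pow_mul (i : ℕ) (a : ℤ) : |(-1) ^ i * a| = |a| := by
  rw [abs_mul, abs_pow, abs_neg, abs_one, one_pow, one_mul]

theorem mem_vertexSet_hat_iff {n k : ℕ} (hk : 1 ≤ k) {A : Finset ℤ} :
    A ∈ (schrijverSignedGraphHat n k).graph.vertexSet ↔
      AlternatingPos k A ∧ ∀ a ∈ A, |a| ≤ (n : ℤ) := by
  rw [mem_vertexSet_hat]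
  constructor
  · rintro ⟨⟨hA, a, ha, hb, h⟩, x, hxA, hx, hmin⟩
    refine ⟨?_, fun a ha => (hA.1 a ha).2⟩
    rcases h with rfl | rfl
    · refine ⟨_, fun i j hij => ?_, fun i => ?_, rfl⟩
      · simp only [abs_neg_one_pow_mul]
        rw [abs_of_pos (hb i).1, abs_of_pos (hb j).1]
        exact ha hij
      · rw [← mul_assoc, ← mul_pow]
        simpa using lt_of_lt_of_le one_pos (hb i).1
    -- In this form the entry of least absolute value is `-a 0`, against `FirstPositive`.
    · exfalso
      obtain ⟨i, -, rfl⟩ := Finset.mem_image.1 hxA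
      have h0 := hmin _ (Finset.mem_image_of_mem _ (Finset.mem_univ ⟨0, hk⟩))
      rw [abs_neg_one_pow_mul, ← abs_of_pos hx, abs_neg_one_pow_mul, abs_of_pos (hb _).1,
        abs_of_pos (hb _).1, ha.le_iff_le] at h0
      have hi : (i : ℕ) = 0 := Nat.le_zero.1 h0
      rw [hi] at hx
      have := (hb i).1
      simp only [zero_add, pow_one] at hx
      omega
  · rintro ⟨⟨b, hb, hs, rfl⟩, hn⟩
    have habs : ∀ i : Fin k, |b i| = (-1) ^ (i : ℕ) * b i := fun i => by
      rw [← abs_of_pos (hs i), abs_neg_one_pow_mul]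
    have hb0 : ∀ i, 1 ≤ |b i| := fun i => by
      rw [habs]
      exact hs i
    have hbn : ∀ i, |b i| ≤ (n : ℤ) := fun i =>
      hn _ (Finset.mem_image_of_mem b (Finset.mem_univ i))
    refine ⟨⟨⟨fun a ha => ?_, ?_, ?_⟩, fun i => |b i|, hb, fun i => ⟨hb0 i, hbn i⟩, Or.inl ?_⟩,
      b ⟨0, hk⟩, Finset.mem_image_of_mem b (Finset.mem_univ _), ?_, ?_⟩
    · obtain ⟨i, -, rfl⟩ := Finset.mem_image.1 ha
      exact ⟨hb0 i, hbn i⟩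
    · exact AlternatingPos.card ⟨b, hb, hs, rfl⟩
    · refine Finset.disjoint_left.2 fun x hx hx' => ?_
      obtain ⟨i, -, rfl⟩ := Finset.mem_image.1 hx
      obtain ⟨j, -, hj⟩ := Finset.mem_image.1 (mem_negSet.1 hx')
      have hij : j = i := hb.injective (by simp [hj])
      subst hij
      have := hb0 j
      rw [show b j = 0 by omega, abs_zero] at this
      omega
    · refine Finset.image_congr fun i _ => ?_
      simp only
      rw [habs, ← mul_assoc, ← mul_pow]
      simp
    · simpa using hs ⟨0, hk⟩
    · intro x hx
      obtain ⟨i, -, rfl⟩ := Finset.mem_image.1 hx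
      have h0 : b ⟨0, hk⟩ = |b ⟨0, hk⟩| := by simpa using (habs ⟨0, hk⟩).symm
      rw [h0]
      exact hb.monotone (Fin.le_def.2 (Nat.zero_le _))

/-- The sign of an element is fixed by its rank in absolute value. Criticality rests on this. -/
theorem AlternatingPos.eq_of_image_abs_eq {k : ℕ} {A B : Finset ℤ} (hA : AlternatingPos k A)
    (hB : AlternatingPos k B) (h : A.image (fun x => |x|) = B.image fun x => |x|) : A = B := by
  obtain ⟨a, ha, hsa, rfl⟩ := hA
  obtain ⟨b, hb, hsb, rfl⟩ := hB
  have h1 : (fun i => |a i|) = fun i => |b i| := by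
    rw [← ha.range_inj hb]
    have h2 := congrArg (fun S : Finset ℤ => (S : Set ℤ)) h
    simpa [← Set.range_comp, Function.comp_def] using h2
  congr 1
  funext i
  have h2 : |a i| = |b i| := congrFun h1 i
  rw [← abs_neg_one_pow_mul i, abs_of_pos (hsa i), ← abs_neg_one_pow_mul i (b i),
    abs_of_pos (hsb i)] at h2
  exact mul_left_cancel₀ (by simp) h2

theorem finite_vertexSet_hat (n k : ℕ) :
    (schrijverSignedGraphHat n k).graph.vertexSet.Finite := by
  refine (Finset.finite_toSet (Finset.Icc (-n : ℤ) n).powerset).subset fun A hA => ?_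
  rw [Finset.mem_coe, Finset.mem_powerset]
  intro a ha
  rw [Finset.mem_Icc, ← abs_le]
  exact ((mem_vertexSet_hat.1 hA).1.1.1 a ha).2

theorem isSignVector_of_mem_vertexSet_hat {n k : ℕ} (hk : 1 ≤ k) {A : Finset ℤ}
    (hA : A ∈ (schrijverSignedGraphHat n k).graph.vertexSet) : IsSignVector n A := by
  obtain ⟨h1, h2, h3⟩ := (mem_vertexSet_hat.1 hA).1.1
  refine ⟨Finset.card_pos.1 (by omega), fun x hx => ⟨?_, (h1 x hx).2⟩, fun x hx hx' => ?_⟩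
  · rintro rfl
    have := (h1 0 hx).1
    simp at this
  · exact Finset.disjoint_left.1 h3 hx (mem_negSet.2 hx')

/-! ### Colourings by stars -/

/-- A set of coordinates meeting all vertices of a subgraph gives a balanced colouring by stars. -/
theorem balancedColorable_of_transversal {n k : ℕ} (hk : 1 ≤ k)
    {S : SignedGraph (Finset ℤ) (Sym2 (Finset ℤ) × ℤˣ)}
    (hle : S.graph ≤ (schrijverSignedGraphHat n k).graph) (hsign : ∀ e, S.sign e = e.2)
    (T : Finset ℤ) (hT : ∀ A ∈ S.graph.vertexSet, ∃ x ∈ T, x ∈ A ∨ -x ∈ A) :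
    S.BalancedColorable T.card := by
  classical
  choose f hfT hf using fun A : S.graph.vertexSet => hT A.1 A.2
  refine ⟨fun A => T.equivFin ⟨f A, hfT A⟩, fun i => ?_⟩
  obtain ⟨⟨x, hxT⟩, rfl⟩ := T.equivFin.surjective i
  have hmem : ∀ A ∈ Subtype.val '' ((fun A => T.equivFin ⟨f A, hfT A⟩) ⁻¹' {T.equivFin ⟨x, hxT⟩}),
      A ∈ (schrijverSignedGraphHat n k).graph.vertexSet ∧ (x ∈ A ∨ -x ∈ A) := by
    rintro _ ⟨A, hA, rfl⟩
    have h1 : f A = x := congrArg Subtype.val (T.equivFin.injective hA)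
    exact ⟨hle.vertexSet_mono A.2, h1 ▸ hf A⟩
  -- A positive edge forbids opposite signs at coordinate `x`, and a negative edge forbids equal
  -- ones.
  refine SignedGraph.balanced_of_potential ?_ (fun A => if x ∈ A then 1 else -1) ?_
  · exact (finite_vertexSet_hat n k).subset fun A hA => (hmem A hA).1
  · rintro e A B ⟨hl, hA, hB⟩
    obtain ⟨hAv, hA⟩ := hmem A hA
    obtain ⟨hBv, hB⟩ := hmem B hB
    have hA' := (isSignVector_of_mem_vertexSet_hat hk hAv).2.2 x
    have hB' := (isSignVector_of_mem_vertexSet_hat hk hBv).2.2 x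
    have hl' := (isLink_hat.1 (hle.isLink_mono hl)).1.2
    show S.sign e = _
    rw [hsign]
    rcases hl' with ⟨he, hd⟩ | ⟨he, hd⟩
    · have h1 := fun y (hy : y ∈ A) => Finset.disjoint_left.1 hd hy
      have h2 := h1 x
      have h3 := h1 (-x)
      simp only [mem_negSet, neg_neg] at h2 h3
      by_cases hxA : x ∈ A <;> by_cases hxB : x ∈ B <;> simp [hxA, hxB, he] <;> tauto
    · have h1 := fun y (hy : y ∈ A) => Finset.disjoint_left.1 hd hy
      have h2 := h1 x
      have h3 := h1 (-x)
      by_cases hxA : x ∈ A <;> by_cases hxB : x ∈ B <;> simp [hxA, hxB, he] <;> tauto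

theorem balancedColorable_hat {n k : ℕ} (hk : 1 ≤ k) (hkn : k ≤ n) :
    (schrijverSignedGraphHat n k).BalancedColorable (n - k + 1) := by
  have hcard : (Finset.Icc (1 : ℤ) (n - k + 1 : ℕ)).card = n - k + 1 := by
    rw [Int.card_Icc]
    omega
  rw [← hcard]
  refine balancedColorable_of_transversal hk le_rfl (fun _ => rfl) _ fun A hA => ?_
  obtain ⟨halt, hAn⟩ := (mem_vertexSet_hat_iff hk).1 hA
  have hsv := isSignVector_of_mem_vertexSet_hat hk hA
  by_contra! hno
  have hsub : A.image (fun x => |x|) ⊆ Finset.Icc ((n - k + 2 : ℕ) : ℤ) n := by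
    intro y hy
    obtain ⟨x, hx, rfl⟩ := Finset.mem_image.1 hy
    refine Finset.mem_Icc.2 ⟨?_, hAn x hx⟩
    by_contra! hlt
    have h1 := hno |x| (Finset.mem_Icc.2 ⟨Int.one_le_abs (hsv.2.1 x hx).1, by omega⟩)
    rcases abs_choice x with h | h
    · exact h1.1 (by rwa [h])
    · exact h1.2 (by rwa [h, neg_neg])
  have h2 := Finset.card_le_card hsub
  rw [halt.card_image_abs, Int.card_Icc] at h2
  omega

theorem balancedColorable_hat_deleteVertex {n k : ℕ} (hk : 1 ≤ k) {A : Finset ℤ}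
    (hA : A ∈ (schrijverSignedGraphHat n k).graph.vertexSet) :
    ((schrijverSignedGraphHat n k).deleteVertex A).BalancedColorable (n - k) := by
  obtain ⟨halt, hAn⟩ := (mem_vertexSet_hat_iff hk).1 hA
  have hsv := isSignVector_of_mem_vertexSet_hat hk hA
  -- A vertex missing all coordinates outside `|A|` has the absolute values of `A`, hence equals
  -- `A`.
  have hcard : (Finset.Icc (1 : ℤ) n \ A.image (fun x => |x|)).card = n - k := by
    rw [Finset.card_sdiff_of_subset, halt.card_image_abs, Int.card_Icc]
    · omega
    · intro y hy
      obtain ⟨x, hx, rfl⟩ := Finset.mem_image.1 hy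
      exact Finset.mem_Icc.2 ⟨Int.one_le_abs (hsv.2.1 x hx).1, hAn x hx⟩
  rw [← hcard]
  refine balancedColorable_of_transversal hk Graph.deleteVerts_le (fun _ => rfl) _ fun B hB => ?_
  obtain ⟨hB, hBA⟩ := hB
  obtain ⟨haltB, hBn⟩ := (mem_vertexSet_hat_iff hk).1 hB
  have hsvB := isSignVector_of_mem_vertexSet_hat hk hB
  by_contra! hno
  refine hBA (haltB.eq_of_image_abs_eq halt (Finset.eq_of_subset_of_card_le (fun y hy => ?_) ?_))
  · obtain ⟨x, hx, rfl⟩ := Finset.mem_image.1 hy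
    by_contra hyA
    have h1 := hno |x| (Finset.mem_sdiff.2
      ⟨Finset.mem_Icc.2 ⟨Int.one_le_abs (hsvB.2.1 x hx).1, hBn x hx⟩, hyA⟩)
    rcases abs_choice x with h | h
    · exact h1.1 (by rwa [h])
    · exact h1.2 (by rwa [h, neg_neg])
  · rw [halt.card_image_abs, haltB.card_image_abs]

/-! ### The lower bound and the theorem -/

theorem lt_of_balancedColorable_hat {n k p : ℕ} (hk : 1 ≤ k) (hkn : k ≤ n)
    (h : (schrijverSignedGraphHat n k).BalancedColorable p) : n - k < p := by
  by_contra! hp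
  obtain ⟨f, hf⟩ := h
  choose s hs using fun i => (hf i).exists_potential
  -- The family of colour `c` consists of the sets `s(B) B` with `B` in that class.
  refine no_small_cover (n := n) (p := p) hk (by omega)
    (fun c A => ∃ B : (schrijverSignedGraphHat n k).graph.vertexSet, (f B : ℕ) = c ∧
      ((s (f B) B = 1 ∧ A = B) ∨ (s (f B) B = -1 ∧ A = negSet B))) ?_ ?_
  · intro A hA hAn
    have hv := (mem_vertexSet_hat_iff hk).2 ⟨hA, hAn⟩
    refine ⟨f ⟨A, hv⟩, (f ⟨A, hv⟩).2, ?_⟩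
    rcases Int.units_eq_one_or (s (f ⟨A, hv⟩) A) with h | h
    · exact Or.inl ⟨⟨A, hv⟩, rfl, Or.inl ⟨h, rfl⟩⟩
    · exact Or.inr ⟨⟨A, hv⟩, rfl, Or.inr ⟨h, rfl⟩⟩
  · rintro _ X A B hX hA hB ⟨A', rfl, hA'⟩ ⟨B', hBc, hB'⟩
    have hfB : f B' = f A' := Fin.ext hBc
    rw [hfB] at hB'
    have hsign : ∀ ε : ℤˣ, ((ε = 1 ∧ Disjoint A'.1 (negSet B')) ∨ (ε = -1 ∧ Disjoint A'.1 B')) →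
        ε = s (f A') A' * s (f A') B' := fun ε hε =>
      hs (f A') (s(A'.1, B'.1), ε) A' B'
        ⟨isLink_hat.2 ⟨⟨rfl, hε⟩, A'.2, B'.2⟩, ⟨A', rfl, rfl⟩, ⟨B', hfB, rfl⟩⟩
    have hBX : negSet B ⊆ negSet X := negSet_subset_negSet.2 hB
    have hdisj : Disjoint X (negSet X) :=
      Finset.disjoint_left.2 fun x hx hx' => hX.2.2 x hx (mem_negSet.1 hx')
    have hne : (1 : ℤˣ) ≠ -1 := by decide
    -- If `s(A') A' ⊆ X` and `s(B') B' ⊆ -X`, there is an edge of sign `-s(A') s(B')` between `A'`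
    -- and `B'`, against the potential.
    rcases hA' with ⟨hsA, rfl⟩ | ⟨hsA, rfl⟩ <;> rcases hB' with ⟨hsB, hB'⟩ | ⟨hsB, hB'⟩
    · rw [hB'] at hBX
      have h1 := hsign (-1) (Or.inr ⟨rfl, hdisj.mono hA hBX⟩)
      rw [hsA, hsB] at h1
      exact hne (by simpa using h1.symm)
    · rw [hB'] at hBX
      have h1 := hsign 1 (Or.inl ⟨rfl, hdisj.mono hA hBX⟩)
      rw [hsA, hsB] at h1
      simp at h1
    · rw [hB'] at hBX
      rw [← negSet_subset_negSet, negSet_negSet] at hA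
      have h1 := hsign 1 (Or.inl ⟨rfl, hdisj.symm.mono hA
        (by rw [← negSet_negSet X]; exact negSet_subset_negSet.2 hBX)⟩)
      rw [hsA, hsB] at h1
      simp at h1
    · rw [hB', negSet_subset_negSet] at hBX
      rw [← negSet_subset_negSet, negSet_negSet] at hA
      have h1 := hsign (-1) (Or.inr ⟨rfl, hdisj.symm.mono hA hBX⟩)
      rw [hsA, hsB] at h1
      exact hne (by simpa using h1.symm)

theorem theorem8 (n k : ℕ) (hk : 1 ≤ k) (hkn : k ≤ n) :
    (schrijverSignedGraphHat n k).balancedChromaticNumber = ((n - k + 1 : ℕ) : ℕ∞) ∧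
    (∀ A ∈ (schrijverSignedGraphHat n k).graph.vertexSet,
      ((schrijverSignedGraphHat n k).deleteVertex A).BalancedColorable (n - k)) ∧
    (schrijverSignedGraphHat n k).VertexCritical := by
  have hchi : (schrijverSignedGraphHat n k).balancedChromaticNumber = ((n - k + 1 : ℕ) : ℕ∞) := by
    refine le_antisymm (iInf₂_le _ (balancedColorable_hat hk hkn)) (le_iInf₂ fun p hp => ?_)
    exact_mod_cast lt_of_balancedColorable_hat hk hkn hp
  have hdel : ∀ A ∈ (schrijverSignedGraphHat n k).graph.vertexSet,
      ((schrijverSignedGraphHat n k).deleteVertex A).BalancedColorable (n - k) :=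
    fun A hA => balancedColorable_hat_deleteVertex hk hA
  refine ⟨hchi, hdel, fun A hA => ?_⟩
  rw [hchi]
  refine lt_of_le_of_lt (iInf₂_le _ (hdel A hA)) ?_
  exact_mod_cast Nat.lt_succ_self (n - k)
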